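/- Let $\mathsf{PreOrdGrp}$ be the category whose objects are pairs $(G,P_G)$, where $G$ is a group and $P_G\subseteq G$ is a submonoid closed under conjugation in $G$ (the positive cone), and whose morphisms $(G,P_G)\to(H,P_H)$ are the group homomorphisms $f\colon G\to H$ with $f(P_G)\subseteq P_H$. Let $\mathsf{Mono(Ab)}$ be its full subcategory of pairs $(A,P_A)$ with $A$ an abelian group and $P_A$ a subgroup of $A$, and let $U\colon\mathsf{Mono(Ab)}\to\mathsf{PreOrdGrp}$ be the inclusion. For a group $G$ let $\eta_G\colon G\to \mathrm{ab}(G)=G/[G,G]$ be the quotient map, and let $F\colon\mathsf{PreOrdGrp}\to\mathsf{Mono(Ab)}$ be the left adjoint of $U$ given by $$F(G,P_G)=\bigl(\mathrm{ab}(G),\,\mathrm{grp}(\eta_G(P_G))\bigr),$$ with unit $\eta$, where for a submonoid $M$ of an abelian group $X$ the group completion $\mathrm{grp}(M)$ is identified with its (isomorphic) image in $X$, the subgroup of all differences of elements of $M$. Let $\mathscr{E}$ and $\mathscr{Z}$ be the classes of regular epimorphisms in $\mathsf{PreOrdGrp}$ and in $\mathsf{Mono(Ab)}$, respectively. A Galois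 structure $(\mathscr{C},\mathscr{F},F,U,\mathscr{E},\mathscr{Z})$ consists of an adjunction $F\dashv U$ with $F\colon\mathscr{C}\to\mathscr{F}$, unit $\eta$ and counit $\epsilon$, together with classes $\mathscr{E}$, $\mathscr{Z}$ of morphisms of $\mathscr{C}$, $\mathscr{F}$ such that: $\mathscr{C}$ and $\mathscr{F}$ have all pullbacks along morphisms of $\mathscr{E}$ and $\mathscr{Z}$, respectively; $\mathscr{E}$ and $\mathscr{Z}$ contain all isomorphisms, are closed under composition and are pullback-stable; $F(\mathscr{E})\subseteq\mathscr{Z}$ and $U(\mathscr{Z})\subseteq\mathscr{E}$. For $B\in\mathscr{C}$, let $\mathscr{E}(B)$ be the full subcategory of the slice category $\mathscr{C}\downarrow B$ on the morphisms $A\to B$ in $\mathscr{E}$, and define $\mathscr{Z}(F(B))$ likewise. A Galois structure induces an adjunction $F^B\dashv U^B$ with $F^B\colon\mathscr{E}(B)\to\mathscr{Z}(F(B))$, $F^B(A,f)=(F(A),F(f))$, where $U^B(X,\varphi)$ is the pullback of $U(\varphi)$ along $\eta_B\colon B\to UF(B)$. It is admissible when, for every $B\in\mathscr{C}$, the counit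 of the adjunction $F^B\dashv U^B$ is an isomorphism. Then $\Gamma=(\mathsf{PreOrdGrp},\mathsf{Mono(Ab)},F,U,\mathscr{E},\mathscr{Z})$ is a Galois structure, and it is admissible. -/

import Mathlib

open CategoryTheory CategoryTheory.Limits

universe v₁ v₂ u₁ u₂ u

/-! ## Galois structures and admissibility -/

section Galois

variable {C : Type u₁} [Category.{v₁} C] {D : Type u₂} [Category.{v₂} D]
  {L : C ⥤ D} {R : D ⥤ C}

/-- The system `(C, D, L, R, E, Z)`, with `adj : L ⊣ R` an adjunction, `E` a class of morphisms of
`C` and `Z` a class of morphisms of `D`, is a Galois structure. -/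
structure IsGaloisStructure (adj : L ⊣ R) (E : MorphismProperty C) (Z : MorphismProperty D) :
    Prop where
  hasPullbacks_left : E.HasPullbacks
  hasPullbacks_right : Z.HasPullbacks
  comp_left : E.IsStableUnderComposition
  comp_right : Z.IsStableUnderComposition
  isos_left : MorphismProperty.isomorphisms C ≤ E
  isos_right : MorphismProperty.isomorphisms D ≤ Z
  baseChange_left : E.IsStableUnderBaseChange
  baseChange_right : Z.IsStableUnderBaseChange
  map_left : ∀ ⦃X Y : C⦄ (f : X ⟶ Y), E f → Z (L.map f)
  map_right : ∀ ⦃X Y : D⦄ (f : X ⟶ Y), Z f → E (R.map f)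

/-- The category `E(B)` of extensions of `B`: the full subcategory of the slice category over `B`
on the morphisms in the class `E`. -/
abbrev Extensions (E : MorphismProperty C) (B : C) :=
  (E.overObj (X := B)).FullSubcategory

namespace IsGaloisStructure

variable {adj : L ⊣ R} {E : MorphismProperty C} {Z : MorphismProperty D}

/-- The functor `E(B) ⥤ Z(L B)`, `(A, f) ↦ (L A, L f)`. -/
def extLeft (h : IsGaloisStructure adj E Z) (B : C) :
    Extensions E B ⥤ Extensions Z (L.obj B) :=
  ObjectProperty.lift _ ((E.overObj (X := B)).ι ⋙ Over.post L)
    (fun A => h.map_left _ A.property)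

theorem hasPullback_unit (h : IsGaloisStructure adj E Z) (B : C)
    (X : Extensions Z (L.obj B)) : HasPullback (R.map X.obj.hom) (adj.unit.app B) :=
  h.hasPullbacks_left.hasPullback _ (h.map_right _ X.property)

/-- The functor `Z(L B) ⥤ E(B)` which sends `(X, φ)` to the pullback of `R φ` along the
component at `B` of the unit of the adjunction. -/
noncomputable def extRight (h : IsGaloisStructure adj E Z) (B : C) :
    Extensions Z (L.obj B) ⥤ Extensions E B where
  obj X :=
    haveI := h.hasPullback_unit B X
    haveI := h.baseChange_left
    ⟨Over.mk (pullback.snd (R.map X.obj.hom) (adj.unit.app B)),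
      MorphismProperty.pullback_snd (P := E) _ _ (h.map_right _ X.property)⟩
  map {X Y} g :=
    haveI := h.hasPullback_unit B X
    haveI := h.hasPullback_unit B Y
    ObjectProperty.homMk (Over.homMk
      (pullback.lift (pullback.fst _ _ ≫ R.map g.hom.left) (pullback.snd _ _) (by
        rw [Category.assoc, ← R.map_comp, Over.w, pullback.condition]))
      (pullback.lift_snd _ _ _))
  map_id X := by
    have := h.hasPullback_unit B X
    ext
    apply pullback.hom_ext <;> simp
  map_comp {X Y W} f g := by
    have := h.hasPullback_unit B X
    have := h.hasPullback_unit B Y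
    have := h.hasPullback_unit B W
    ext
    refine pullback.hom_ext ?_ ?_
    · refine (pullback.lift_fst _ _ _).trans (Eq.trans ?_ (Category.assoc _ _ _).symm)
      refine Eq.trans ?_ (congrArg _ (pullback.lift_fst _ _ _).symm)
      refine Eq.trans ?_ (pullback.lift_fst_assoc _ _ _ _).symm
      simp
    · refine (pullback.lift_snd _ _ _).trans (Eq.trans ?_ (Category.assoc _ _ _).symm)
      refine Eq.trans ?_ (congrArg _ (pullback.lift_snd _ _ _).symm)
      exact (pullback.lift_snd _ _ _).symm

/-- The adjunction between categories of extensions induced by a Galois structure: a morphism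
`L A ⟶ X` over `L B` corresponds to the morphism into the pullback whose components are its
transpose `A ⟶ R X` and the structure morphism `A ⟶ B`. -/
noncomputable def extAdj (h : IsGaloisStructure adj E Z) (B : C) :
    h.extLeft B ⊣ h.extRight B :=
  Adjunction.mkOfHomEquiv
    { homEquiv := fun A X =>
        haveI := h.hasPullback_unit B X
        { toFun := fun g => ObjectProperty.homMk (Over.homMk
            (pullback.lift (adj.homEquiv _ _ g.hom.left) A.obj.hom (by
              have hw : g.hom.left ≫ X.obj.hom = L.map A.obj.hom := Over.w g.hom
              refine (adj.homEquiv_naturality_right _ _).symm.trans ?_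
              refine (congrArg (adj.homEquiv _ _) hw).trans ?_
              exact (adj.homEquiv_unit _ _ _).trans (adj.unit.naturality A.obj.hom).symm))
            (pullback.lift_snd _ _ _))
          invFun := fun k => ObjectProperty.homMk (Over.homMk
            ((adj.homEquiv _ _).symm (k.hom.left ≫ pullback.fst _ _)) (by
              have hw : k.hom.left ≫ pullback.snd _ _ = A.obj.hom := Over.w k.hom
              refine (adj.homEquiv_naturality_right_symm _ _).symm.trans ?_
              refine (Equiv.symm_apply_eq _).2 ?_
              refine (Category.assoc _ _ _).trans ?_
              refine (congrArg _ pullback.condition).trans ?_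
              refine (Category.assoc _ _ _).symm.trans ?_
              refine (congrArg (· ≫ _) hw).trans ?_
              exact (adj.unit.naturality A.obj.hom).trans (adj.homEquiv_unit _ _ _).symm))
          left_inv := fun g => by
            ext
            refine (congrArg (adj.homEquiv _ _).symm (pullback.lift_fst _ _ _)).trans ?_
            exact (adj.homEquiv _ _).symm_apply_apply _
          right_inv := fun k => by
            have hw : k.hom.left ≫ pullback.snd _ _ = A.obj.hom := Over.w k.hom
            ext
            refine pullback.hom_ext ?_ ?_
            · exact (pullback.lift_fst _ _ _).trans ((adj.homEquiv _ _).apply_symm_apply _)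
            · exact (pullback.lift_snd _ _ _).trans hw.symm }
      homEquiv_naturality_left_symm := fun f g => by
        ext
        refine (congrArg (adj.homEquiv _ _).symm (Category.assoc _ _ _)).trans ?_
        exact adj.homEquiv_naturality_left_symm _ _
      homEquiv_naturality_right := fun {A X Y} f g => by
        have := h.hasPullback_unit B X
        have := h.hasPullback_unit B Y
        ext
        refine pullback.hom_ext ?_ ?_
        · refine (pullback.lift_fst _ _ _).trans ?_
          refine (adj.homEquiv_naturality_right _ _).trans ?_
          refine Eq.trans ?_ (Category.assoc _ _ _).symm
          refine Eq.trans ?_ (congrArg _ (pullback.lift_fst _ _ _).symm)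
          exact (pullback.lift_fst_assoc _ _ _ _).symm
        · refine (pullback.lift_snd _ _ _).trans ?_
          refine Eq.trans ?_ (Category.assoc _ _ _).symm
          refine Eq.trans ?_ (congrArg _ (pullback.lift_snd _ _ _).symm)
          exact (pullback.lift_snd _ _ _).symm }

/-- A Galois structure is admissible when, for every object `B`, the counit of the induced
adjunction between `E(B)` and `Z(L B)` is an isomorphism. -/
def IsAdmissible (h : IsGaloisStructure adj E Z) : Prop :=
  ∀ B : C, IsIso (h.extAdj B).counit

end IsGaloisStructure

end Galois

/-! ## Preordered groups -/

/-- A preordered group, given by a group (written multiplicatively) together with its positive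
cone, a submonoid closed under conjugation. -/
structure PreOrdGrp where
  carrier : Type u
  [group : Group carrier]
  cone : Submonoid carrier
  conj_mem : ∀ g x : carrier, x ∈ cone → g * x * g⁻¹ ∈ cone

namespace PreOrdGrp

attribute [instance] PreOrdGrp.group

/-- Morphisms of preordered groups: group homomorphisms which restrict to the positive cones. -/
@[ext]
structure Hom (G H : PreOrdGrp.{u}) where
  toMonoidHom : G.carrier →* H.carrier
  map_cone : ∀ x ∈ G.cone, toMonoidHom x ∈ H.cone

instance : Category PreOrdGrp.{u} where
  Hom := Hom
  id G := ⟨MonoidHom.id _, fun _ hx => hx⟩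
  comp f g := ⟨g.toMonoidHom.comp f.toMonoidHom, fun x hx => g.map_cone _ (f.map_cone x hx)⟩

@[ext]
theorem hom_ext {G H : PreOrdGrp.{u}} {f g : G ⟶ H}
    (h : Hom.toMonoidHom f = Hom.toMonoidHom g) : f = g :=
  Hom.ext h

/-- The preordered groups `(A, P)` for which `A` is abelian and `P` is a subgroup of `A`. -/
def isMonoAb : ObjectProperty PreOrdGrp.{u} := fun G =>
  (∀ x y : G.carrier, x * y = y * x) ∧ ∀ x ∈ G.cone, x⁻¹ ∈ G.cone

/-- The category `Mono(Ab)` of monomorphisms of abelian groups, as the full subcategory of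
`PreOrdGrp` on the pairs `(A, P)` with `A` an abelian group and `P` a subgroup of `A`. -/
abbrev MonoAb := (isMonoAb.{u}).FullSubcategory

/-- The inclusion functor `U`. -/
abbrev inclusion : MonoAb.{u} ⥤ PreOrdGrp.{u} := (isMonoAb.{u}).ι

/-- For a submonoid `M` of an abelian group `A`, the group completion (Grothendieck group) `grp(M)`
of `M`, regarded as a subgroup of `A` through the homomorphism `grp(M) → A` induced by the inclusion
of `M`; this homomorphism is injective by `lift_subtype_injective`. -/
noncomputable def grp {A : Type u} [CommGroup A] (M : Submonoid A) : Subgroup A :=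
  (Algebra.GrothendieckGroup.lift M.subtype).range

theorem lift_mk {A : Type u} [CommGroup A] (M : Submonoid A) (a : M) (b : (⊤ : Submonoid M)) :
    Algebra.GrothendieckGroup.lift M.subtype (Localization.mk a b) = (a : A) / ((b : M) : A) := by
  have h : Localization.mk a b =
      Algebra.GrothendieckGroup.of a / Algebra.GrothendieckGroup.of (b : M) := by
    simp [Algebra.GrothendieckGroup.of, ← Localization.mk_one_eq_monoidOf_mk]
  have h2 : ∀ m : M, Algebra.GrothendieckGroup.lift M.subtype (Algebra.GrothendieckGroup.of m) = m :=
    fun m => DFunLike.congr_fun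
      (Algebra.GrothendieckGroup.lift.symm_apply_apply M.subtype) m
  rw [h, map_div, h2, h2]

theorem lift_subtype_injective {A : Type u} [CommGroup A] (M : Submonoid A) :
    Function.Injective (Algebra.GrothendieckGroup.lift M.subtype) := by
  refine (injective_iff_map_eq_one _).2 fun x => ?_
  induction x using Localization.ind with
  | _ y =>
    obtain ⟨a, b⟩ := y
    intro hx
    rw [lift_mk, div_eq_one] at hx
    have hab : a = b := Subtype.ext hx
    subst hab
    exact Localization.mk_self b

/-- As a subgroup of `A`, the group completion of `M` is the set of quotients of elements
of `M`. -/
theorem mem_grp {A : Type u} [CommGroup A] (M : Submonoid A) (x : A) :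
    x ∈ grp M ↔ ∃ a ∈ M, ∃ b ∈ M, x = a / b := by
  constructor
  · rintro ⟨y, rfl⟩
    induction y using Localization.ind with
    | _ y => exact ⟨y.1, y.1.2, y.2, (y.2 : M).2, lift_mk M y.1 y.2⟩
  · rintro ⟨a, ha, b, hb, rfl⟩
    exact ⟨Localization.mk ⟨a, ha⟩ ⟨⟨b, hb⟩, trivial⟩, lift_mk M _ _⟩

/-- The subgroup `grp(η_G(P))` of `ab(G)`, where `η_G : G → ab(G) = G/[G, G]` is the quotient
map. -/
noncomputable def reflCone (G : PreOrdGrp.{u}) : Subgroup (Abelianization G.carrier) :=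
  grp (G.cone.map Abelianization.of)

theorem mem_reflCone (G : PreOrdGrp.{u}) (x : Abelianization G.carrier) :
    x ∈ reflCone G ↔
      ∃ a ∈ G.cone, ∃ b ∈ G.cone, x = Abelianization.of a / Abelianization.of b := by
  constructor
  · intro hx
    obtain ⟨_, ⟨a, ha, rfl⟩, _, ⟨b, hb, rfl⟩, rfl⟩ := (mem_grp _ _).1 hx
    exact ⟨a, ha, b, hb, rfl⟩
  · rintro ⟨a, ha, b, hb, rfl⟩
    exact (mem_grp _ _).2 ⟨_, ⟨a, ha, rfl⟩, _, ⟨b, hb, rfl⟩, rfl⟩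

/-- The object `F(G, P) = (ab(G), grp(η_G(P)))`. -/
noncomputable def reflObj (G : PreOrdGrp.{u}) : MonoAb.{u} where
  obj :=
    { carrier := Abelianization G.carrier
      cone := (reflCone G).toSubmonoid
      conj_mem := fun g x hx => by
        rw [mul_comm g x, mul_inv_cancel_right]; exact hx }
  property := ⟨fun x y => mul_comm (G := Abelianization G.carrier) x y,
    fun _ hx => inv_mem (S := Subgroup (Abelianization G.carrier)) hx⟩

/-- The functor `F`. -/
noncomputable def refl : PreOrdGrp.{u} ⥤ MonoAb.{u} where
  obj := reflObj
  map {G H} f := ObjectProperty.homMk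
    (⟨Abelianization.map (Hom.toMonoidHom f), fun x hx => by
      obtain ⟨a, ha, b, hb, rfl⟩ := (mem_reflCone G x).1 hx
      exact (mem_reflCone H _).2 ⟨_, Hom.map_cone f a ha, _, Hom.map_cone f b hb,
        map_div (Abelianization.map (Hom.toMonoidHom f)) _ _⟩⟩ : Hom _ _)
  map_id G := by
    ext : 2
    exact Abelianization.map_id
  map_comp f g := by
    ext : 2
    exact (Abelianization.map_comp _ _).symm

/-- The group of an object of `Mono(Ab)` is commutative. -/
abbrev commGroup (X : MonoAb.{u}) : CommGroup X.obj.carrier :=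
  { X.obj.group with mul_comm := X.property.1 }

/-- The unit `η_G : (G, P) ⟶ F(G, P)`, the quotient map. -/
noncomputable def unit (G : PreOrdGrp.{u}) : G ⟶ (reflObj G).obj :=
  (⟨Abelianization.of, fun x hx =>
    (mem_reflCone G _).2 ⟨x, hx, 1, one_mem _,
      (by rw [map_one, div_one] : Abelianization.of x = Abelianization.of x / Abelianization.of 1)⟩⟩ : Hom _ _)

/-- The morphism `F(G, P) ⟶ X` induced by a morphism `(G, P) ⟶ X`. -/
noncomputable def desc {G : PreOrdGrp.{u}} {X : MonoAb.{u}} (f : G ⟶ X.obj) : reflObj G ⟶ X :=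
  letI := commGroup X
  let φ : Abelianization G.carrier →* X.obj.carrier := Abelianization.lift (Hom.toMonoidHom f)
  ObjectProperty.homMk (⟨φ, fun x hx => by
    obtain ⟨a, ha, b, hb, rfl⟩ := (mem_reflCone G x).1 hx
    have h := X.obj.cone.mul_mem (Hom.map_cone f a ha) (X.property.2 _ (Hom.map_cone f b hb))
    rw [← div_eq_mul_inv] at h
    exact Eq.mpr (congrArg (· ∈ X.obj.cone)
      (map_div φ (Abelianization.of a) (Abelianization.of b))) h⟩ : Hom _ _)

theorem unit_desc {G : PreOrdGrp.{u}} {X : MonoAb.{u}} (f : G ⟶ X.obj) :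
    unit G ≫ (desc f).hom = f := rfl

theorem refl_hom_ext {G : PreOrdGrp.{u}} {X : MonoAb.{u}} {f g : reflObj G ⟶ X}
    (h : unit G ≫ f.hom = unit G ≫ g.hom) : f = g := by
  let := commGroup X
  ext : 2
  exact Abelianization.hom_ext (A := X.obj.carrier) _ _ (congrArg Hom.toMonoidHom h)

/-- The adjunction `F ⊣ U`: a morphism `F(G, P) ⟶ X` corresponds to its composite with `η_G`. -/
noncomputable def reflAdj : refl.{u} ⊣ inclusion.{u} :=
  Adjunction.mkOfHomEquiv
    { homEquiv := fun G X =>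
        { toFun := fun f => unit G ≫ f.hom
          invFun := desc
          left_inv := fun _ => refl_hom_ext rfl
          right_inv := fun _ => rfl }
      homEquiv_naturality_left_symm := fun _ _ => refl_hom_ext rfl
      homEquiv_naturality_right := fun _ _ => rfl }

end PreOrdGrp

/-! In both categories the regular epimorphisms are exactly the morphisms surjective on groups and
on positive cones (`isRegularEpi_iff`, `isRegularEpi_monoAb_iff`). With this description the axioms
of a Galois structure are checked on elements.

For admissibility, let `A` be the pullback of `φ : X ⟶ F(B)` along `η_B`, with projections `p` to
`X` and `q` to `B`. The counit is the map `F(A) ⟶ X` induced by `p`, and `isIso_desc_of_isPullback`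
inverts it. It is surjective because `η_B` is. It is injective because `q` maps `[A, A]` onto `[B,
B]` while `p` kills `[A, A]`, so that `ker p = [A, A]`. It is surjective on cones because a
difference `η(a) / η(b)` of positive elements can be lifted through `φ` after `η(b)` alone has been
lifted. -/

namespace PreOrdGrp

/-! ### Elementwise properties of morphisms. -/

theorem comp_apply {G H K : PreOrdGrp.{u}} (f : G ⟶ H) (g : H ⟶ K) (x : G.carrier) :
    Hom.toMonoidHom (f ≫ g) x = Hom.toMonoidHom g (Hom.toMonoidHom f x) := rfl

theorem hom_apply_eq {G H : PreOrdGrp.{u}} {f g : G ⟶ H} (h : f = g) (x : G.carrier) :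
    Hom.toMonoidHom f x = Hom.toMonoidHom g x := by rw [h]

theorem mono_of_injective {G H : PreOrdGrp.{u}} (f : G ⟶ H)
    (hf : Function.Injective (Hom.toMonoidHom f)) : Mono f where
  right_cancellation a b h := by
    ext x
    exact hf (hom_apply_eq h x)

/-- A morphism of preordered groups is surjective on the groups and on the positive cones. -/
def IsConeSurjective {G H : PreOrdGrp.{u}} (f : G ⟶ H) : Prop :=
  Function.Surjective (Hom.toMonoidHom f) ∧
    ∀ y ∈ H.cone, ∃ x ∈ G.cone, Hom.toMonoidHom f x = y

theorem IsConeSurjective.comp {G H K : PreOrdGrp.{u}} {f : G ⟶ H} {g : H ⟶ K}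
    (hf : IsConeSurjective f) (hg : IsConeSurjective g) : IsConeSurjective (f ≫ g) := by
  refine ⟨hg.1.comp hf.1, fun z hz => ?_⟩
  obtain ⟨y, hy, rfl⟩ := hg.2 z hz
  obtain ⟨x, hx, rfl⟩ := hf.2 y hy
  exact ⟨x, hx, rfl⟩

/-- A bijective morphism which is surjective on the positive cones is an isomorphism. -/
theorem IsConeSurjective.isIso {G H : PreOrdGrp.{u}} {f : G ⟶ H} (hf : IsConeSurjective f)
    (hi : Function.Injective (Hom.toMonoidHom f)) : IsIso f := by
  let e := MulEquiv.ofBijective (Hom.toMonoidHom f) ⟨hi, hf.1⟩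
  refine ⟨(⟨e.symm.toMonoidHom, fun y hy => ?_⟩ : Hom H G), ?_, ?_⟩
  · obtain ⟨x, hx, rfl⟩ := hf.2 y hy
    have : e.symm (e x) = x := e.symm_apply_apply x
    exact (congrArg (· ∈ G.cone) this).mpr hx
  · ext x
    exact e.symm_apply_apply x
  · ext x
    exact e.apply_symm_apply x

/-! ### Images -/

/-- The image of a morphism, with the image of the positive cone as its positive cone. -/
def imageObj {G H : PreOrdGrp.{u}} (f : G ⟶ H) : PreOrdGrp.{u} where
  carrier := (Hom.toMonoidHom f).range
  cone := G.cone.map (Hom.toMonoidHom f).rangeRestrict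
  conj_mem := by
    rintro ⟨_, g, rfl⟩ _ ⟨x, hx, rfl⟩
    exact ⟨g * x * g⁻¹, G.conj_mem g x hx, Subtype.ext (by simp)⟩

/-- The corestriction of a morphism to its image. -/
def toImage {G H : PreOrdGrp.{u}} (f : G ⟶ H) : G ⟶ imageObj f :=
  (⟨(Hom.toMonoidHom f).rangeRestrict, fun x hx => ⟨x, hx, rfl⟩⟩ : Hom G (imageObj f))

/-- The inclusion of the image of a morphism. -/
def imageι {G H : PreOrdGrp.{u}} (f : G ⟶ H) : imageObj f ⟶ H :=
  (⟨(Hom.toMonoidHom f).range.subtype, by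
    rintro _ ⟨x, hx, rfl⟩
    exact Hom.map_cone f x hx⟩ : Hom (imageObj f) H)

theorem toImage_comp_imageι {G H : PreOrdGrp.{u}} (f : G ⟶ H) : toImage f ≫ imageι f = f := rfl

theorem imageι_injective {G H : PreOrdGrp.{u}} (f : G ⟶ H) :
    Function.Injective (Hom.toMonoidHom (imageι f)) := Subtype.val_injective

theorem isMonoAb_imageObj {G H : PreOrdGrp.{u}} (f : G ⟶ H) (hG : isMonoAb G) :
    isMonoAb (imageObj f) := by
  constructor
  · rintro ⟨_, x, rfl⟩ ⟨_, y, rfl⟩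
    exact Subtype.ext ((map_mul (Hom.toMonoidHom f) x y).symm.trans
      ((congrArg _ (hG.1 x y)).trans (map_mul (Hom.toMonoidHom f) y x)))
  · rintro _ ⟨x, hx, rfl⟩
    exact ⟨x⁻¹, hG.2 x hx, map_inv _ _⟩

/-- The cone of `imageObj f` is the image of the cone of `G`, not the trace of the cone of `H`. An
inverse of `imageι f` therefore yields preimages of positive elements that are themselves positive.
-/
theorem isConeSurjective_of_isIso_imageι {G H : PreOrdGrp.{u}} (f : G ⟶ H)
    [IsIso (imageι f)] : IsConeSurjective f := by
  have hs : ∀ y, Hom.toMonoidHom (imageι f) (Hom.toMonoidHom (inv (imageι f)) y) = y :=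
    hom_apply_eq (IsIso.inv_hom_id (imageι f))
  refine ⟨fun y => ?_, fun y hy => ?_⟩
  · obtain ⟨x, hx⟩ := (Hom.toMonoidHom (inv (imageι f)) y).2
    exact ⟨x, hx.trans (hs y)⟩
  · obtain ⟨x, hx, hxy⟩ := Hom.map_cone (inv (imageι f)) y hy
    exact ⟨x, hx, (congrArg Subtype.val hxy).trans (hs y)⟩

/-! ### Pullbacks -/

/-- The pullback of two morphisms, as a subobject of the product. -/
def pullbackObj {G H K : PreOrdGrp.{u}} (f : G ⟶ K) (g : H ⟶ K) : PreOrdGrp.{u} where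
  carrier := MonoidHom.eqLocus ((Hom.toMonoidHom f).comp (MonoidHom.fst _ _))
    ((Hom.toMonoidHom g).comp (MonoidHom.snd _ _))
  cone := (G.cone.prod H.cone).comap (Subgroup.subtype _)
  conj_mem := fun _ _ hx => ⟨G.conj_mem _ _ hx.1, H.conj_mem _ _ hx.2⟩

section

variable {G H K : PreOrdGrp.{u}} (f : G ⟶ K) (g : H ⟶ K)

/-- The first projection of the pullback. -/
def pullbackFst : pullbackObj f g ⟶ G :=
  (⟨(MonoidHom.fst _ _).comp (Subgroup.subtype _), fun _ hx => hx.1⟩ : Hom (pullbackObj f g) G)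

/-- The second projection of the pullback. -/
def pullbackSnd : pullbackObj f g ⟶ H :=
  (⟨(MonoidHom.snd _ _).comp (Subgroup.subtype _), fun _ hx => hx.2⟩ : Hom (pullbackObj f g) H)

theorem isPullback_pullbackObj : IsPullback (pullbackFst f g) (pullbackSnd f g) f g where
  w := by
    ext x
    exact x.2
  isLimit' := ⟨PullbackCone.IsLimit.mk _
    (fun s => (⟨((Hom.toMonoidHom s.fst).prod (Hom.toMonoidHom s.snd)).codRestrict _
      (fun x => hom_apply_eq s.condition x),
      fun x hx => ⟨Hom.map_cone s.fst x hx, Hom.map_cone s.snd x hx⟩⟩ : Hom s.pt (pullbackObj f g)))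
    (fun _ => rfl) (fun _ => rfl) (fun s m h₁ h₂ => by
      ext x
      exact Subtype.ext (Prod.ext (hom_apply_eq h₁ x) (hom_apply_eq h₂ x)))⟩

instance : HasPullbacks PreOrdGrp.{u} :=
  have (X Y Z : PreOrdGrp.{u}) (f : X ⟶ Z) (g : Y ⟶ Z) : HasPullback f g :=
    (isPullback_pullbackObj f g).hasPullback
  hasPullbacks_of_hasLimit_cospan _

theorem isMonoAb_pullbackObj (hG : isMonoAb G) (hH : isMonoAb H) :
    isMonoAb (pullbackObj f g) :=
  ⟨fun _ _ => Subtype.ext (Prod.ext (hG.1 _ _) (hH.1 _ _)),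
    fun _ hx => ⟨hG.2 _ hx.1, hH.2 _ hx.2⟩⟩

end

section

variable {W G H K : PreOrdGrp.{u}} {p : W ⟶ G} {q : W ⟶ H} {f : G ⟶ K} {g : H ⟶ K}

/-- Transfers the description by compatible pairs to an arbitrary pullback square. One witness
serves both for the equations and for positivity. -/
theorem exists_of_isPullback (sq : IsPullback p q f g) {x : G.carrier} {y : H.carrier}
    (h : Hom.toMonoidHom f x = Hom.toMonoidHom g y) :
    ∃ w, Hom.toMonoidHom p w = x ∧ Hom.toMonoidHom q w = y ∧
      (x ∈ G.cone → y ∈ H.cone → w ∈ W.cone) := by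
  let w₀ : (pullbackObj f g).carrier := ⟨(x, y), h⟩
  let l := sq.lift (pullbackFst f g) (pullbackSnd f g) (isPullback_pullbackObj f g).w
  exact ⟨Hom.toMonoidHom l w₀, hom_apply_eq (sq.lift_fst _ _ _) w₀,
    hom_apply_eq (sq.lift_snd _ _ _) w₀, fun hx hy => Hom.map_cone l w₀ ⟨hx, hy⟩⟩

/-- The comparison `l` with the pullback of pairs has the retraction `r`, so equality can be tested
on the two coordinates. -/
theorem ext_of_isPullback (sq : IsPullback p q f g) {v w : W.carrier}
    (h₁ : Hom.toMonoidHom p v = Hom.toMonoidHom p w)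
    (h₂ : Hom.toMonoidHom q v = Hom.toMonoidHom q w) : v = w := by
  let l := (isPullback_pullbackObj f g).lift p q sq.w
  let r := sq.lift (pullbackFst f g) (pullbackSnd f g) (isPullback_pullbackObj f g).w
  have hl : l ≫ r = 𝟙 W := sq.hom_ext
    (by simp only [l, r, Category.assoc, sq.lift_fst, IsPullback.lift_fst, Category.id_comp])
    (by simp only [l, r, Category.assoc, sq.lift_snd, IsPullback.lift_snd, Category.id_comp])
  have hp : l ≫ pullbackFst f g = p := IsPullback.lift_fst _ _ _ _
  have hq : l ≫ pullbackSnd f g = q := IsPullback.lift_snd _ _ _ _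
  have hvw : Hom.toMonoidHom l v = Hom.toMonoidHom l w := Subtype.ext (Prod.ext
    ((hom_apply_eq hp v).trans (h₁.trans (hom_apply_eq hp w).symm))
    ((hom_apply_eq hq v).trans (h₂.trans (hom_apply_eq hq w).symm)))
  exact (hom_apply_eq hl v).symm.trans
    ((congrArg (Hom.toMonoidHom r) hvw).trans (hom_apply_eq hl w))

theorem IsConeSurjective.of_isPullback (sq : IsPullback p q f g) (hf : IsConeSurjective f) :
    IsConeSurjective q := by
  refine ⟨fun y => ?_, fun y hy => ?_⟩
  · obtain ⟨x, hx⟩ := hf.1 (Hom.toMonoidHom g y)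
    obtain ⟨w, -, hw, -⟩ := exists_of_isPullback sq hx
    exact ⟨w, hw⟩
  · obtain ⟨x, hxc, hx⟩ := hf.2 _ (Hom.map_cone g y hy)
    obtain ⟨w, -, hw, hwc⟩ := exists_of_isPullback sq hx
    exact ⟨w, hwc hxc hy, hw⟩

end

/-! ### Regular epimorphisms -/

/-- `f` is the coequalizer of its kernel pair. Surjectivity on groups gives the factorization, and
surjectivity on cones makes the factorization preserve positivity. -/
theorem IsConeSurjective.existsUnique_desc {G H K : PreOrdGrp.{u}} {f : G ⟶ H}
    (hf : IsConeSurjective f) (k : G ⟶ K) (hk : pullbackFst f f ≫ k = pullbackSnd f f ≫ k) :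
    ∃! l : H ⟶ K, f ≫ l = k := by
  have hker : (Hom.toMonoidHom f).ker ≤ (Hom.toMonoidHom k).ker := fun x hx => by
    -- For `x` in the kernel of `f`, the pair `(x, 1)` lies in the kernel pair.
    have := hom_apply_eq hk ⟨(x, 1), (MonoidHom.mem_ker.1 hx).trans (map_one (Hom.toMonoidHom f)).symm⟩
    exact MonoidHom.mem_ker.2 (this.trans (map_one (Hom.toMonoidHom k)))
  let φ := (Hom.toMonoidHom f).liftOfSurjective hf.1 ⟨Hom.toMonoidHom k, hker⟩
  have hφ : ∀ x, φ (Hom.toMonoidHom f x) = Hom.toMonoidHom k x := fun x =>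
    MonoidHom.liftOfRightInverse_comp_apply _ _ _ _ x
  refine ⟨(⟨φ, fun y hy => ?_⟩ : Hom H K), ?_, fun m hm => ?_⟩
  · obtain ⟨x, hx, rfl⟩ := hf.2 y hy
    rw [hφ]
    exact Hom.map_cone k x hx
  · ext x
    exact hφ x
  · ext y
    obtain ⟨x, rfl⟩ := hf.1 y
    exact (hom_apply_eq hm x).trans (hφ x).symm

/-- A regular epimorphism is strong, so the image inclusion it factors through is a strong
epimorphism and a monomorphism, hence invertible. The converse uses the kernel pair. -/
theorem isRegularEpi_iff {G H : PreOrdGrp.{u}} (f : G ⟶ H) :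
    IsRegularEpi f ↔ IsConeSurjective f := by
  constructor
  · intro hf
    have : StrongEpi (toImage f ≫ imageι f) := (toImage_comp_imageι f).symm ▸ inferInstance
    have : StrongEpi (imageι f) := strongEpi_of_strongEpi (toImage f) _
    have := mono_of_injective _ (imageι_injective f)
    have : IsIso (imageι f) := isIso_of_mono_of_strongEpi _
    exact isConeSurjective_of_isIso_imageι f
  · intro hf
    exact ⟨⟨{ W := pullbackObj f f
              left := pullbackFst f f
              right := pullbackSnd f f
              w := (isPullback_pullbackObj f f).w
              isColimit := Cofork.IsColimit.ofExistsUnique fun s =>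
                hf.existsUnique_desc s.π s.condition }⟩⟩

/-- The argument of `isRegularEpi_iff` stays inside `Mono(Ab)`, since images and kernel pairs of its
morphisms are again objects of it. -/
theorem isRegularEpi_monoAb_iff {X Y : MonoAb.{u}} (f : X ⟶ Y) :
    IsRegularEpi f ↔ IsConeSurjective f.hom := by
  constructor
  · intro hf
    let I : MonoAb.{u} := ⟨imageObj f.hom, isMonoAb_imageObj _ X.property⟩
    let e : X ⟶ I := ObjectProperty.homMk (toImage f.hom)
    let m : I ⟶ Y := ObjectProperty.homMk (imageι f.hom)
    have hem : e ≫ m = f := rfl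
    have : StrongEpi (e ≫ m) := hem.symm ▸ inferInstance
    have : StrongEpi m := strongEpi_of_strongEpi e m
    have : Mono (inclusion.map m) := mono_of_injective _ (imageι_injective f.hom)
    have : Mono m := inclusion.mono_of_mono_map this
    have : IsIso m := isIso_of_mono_of_strongEpi _
    have : IsIso (imageι f.hom) := inferInstanceAs (IsIso m.hom)
    exact isConeSurjective_of_isIso_imageι f.hom
  · intro hf
    let P : MonoAb.{u} := ⟨pullbackObj f.hom f.hom, isMonoAb_pullbackObj _ _ X.property X.property⟩
    exact ⟨⟨{ W := P
              left := ObjectProperty.homMk (pullbackFst f.hom f.hom)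
              right := ObjectProperty.homMk (pullbackSnd f.hom f.hom)
              w := ObjectProperty.hom_ext _ (isPullback_pullbackObj f.hom f.hom).w
              isColimit := Cofork.IsColimit.ofExistsUnique fun s => by
                obtain ⟨l, hl, hu⟩ := hf.existsUnique_desc s.π.hom
                  (congrArg (·.hom) s.condition)
                exact ⟨ObjectProperty.homMk l, ObjectProperty.hom_ext _ hl, fun m hm =>
                  ObjectProperty.hom_ext _ (hu _ (congrArg (·.hom) hm))⟩ }⟩⟩

instance : HasPullbacks MonoAb.{u} :=
  have (X Y Z : MonoAb.{u}) (f : X ⟶ Z) (g : Y ⟶ Z) : HasPullback f g :=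
    let P : MonoAb.{u} := ⟨pullbackObj f.hom g.hom, isMonoAb_pullbackObj _ _ X.property Y.property⟩
    let p : P ⟶ X := ObjectProperty.homMk (pullbackFst f.hom g.hom)
    let q : P ⟶ Y := ObjectProperty.homMk (pullbackSnd f.hom g.hom)
    (IsPullback.of_map_of_faithful (f := p) (g := q) (h := f) (i := g) inclusion
      (isPullback_pullbackObj f.hom g.hom)).hasPullback
  hasPullbacks_of_hasLimit_cospan _

/-! ### The axioms of a Galois structure. -/

theorem IsConeSurjective.refl_map {G H : PreOrdGrp.{u}} {f : G ⟶ H} (hf : IsConeSurjective f) :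
    IsConeSurjective (refl.map f).hom := by
  refine ⟨fun y => ?_, fun y hy => ?_⟩
  · obtain ⟨y, rfl⟩ := QuotientGroup.mk_surjective y
    obtain ⟨x, rfl⟩ := hf.1 y
    exact ⟨Abelianization.of x, rfl⟩
  · obtain ⟨a, ha, b, hb, rfl⟩ := (mem_reflCone H y).1 hy
    obtain ⟨c, hc, rfl⟩ := hf.2 a ha
    obtain ⟨d, hd, rfl⟩ := hf.2 b hb
    exact ⟨Abelianization.of c / Abelianization.of d, (mem_reflCone G _).2 ⟨c, hc, d, hd, rfl⟩,
      map_div (Abelianization.map (Hom.toMonoidHom f)) _ _⟩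

theorem isGaloisStructure : IsGaloisStructure reflAdj.{u}
    (MorphismProperty.regularEpi PreOrdGrp.{u}) (MorphismProperty.regularEpi MonoAb.{u}) where
  hasPullbacks_left := inferInstance
  hasPullbacks_right := inferInstance
  comp_left := ⟨fun f g hf hg => (isRegularEpi_iff _).2
    (((isRegularEpi_iff f).1 hf).comp ((isRegularEpi_iff g).1 hg))⟩
  comp_right := ⟨fun f g hf hg => (isRegularEpi_monoAb_iff _).2
    (((isRegularEpi_monoAb_iff f).1 hf).comp ((isRegularEpi_monoAb_iff g).1 hg))⟩
  isos_left := MorphismProperty.isomorphisms_le_of_containsIdentities _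
  isos_right := MorphismProperty.isomorphisms_le_of_containsIdentities _
  baseChange_left := ⟨fun sq hg => (isRegularEpi_iff _).2
    (((isRegularEpi_iff _).1 hg).of_isPullback sq)⟩
  baseChange_right := ⟨fun sq hg => (isRegularEpi_monoAb_iff _).2
    (((isRegularEpi_monoAb_iff _).1 hg).of_isPullback
      -- The inclusion is a right adjoint, so the square is also a pullback of preordered groups.
      (haveI := reflAdj.{u}.rightAdjoint_preservesLimits; sq.map inclusion))⟩
  map_left _ _ f hf := (isRegularEpi_monoAb_iff _).2 ((isRegularEpi_iff f).1 hf).refl_map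
  map_right _ _ f hf := (isRegularEpi_iff _).2 ((isRegularEpi_monoAb_iff f).1 hf)

/-! ### Admissibility -/

theorem reflAdj_homEquiv_symm {G : PreOrdGrp.{u}} {X : MonoAb.{u}} (f : G ⟶ X.obj) :
    (reflAdj.homEquiv G X).symm f = desc f := by
  rw [reflAdj, Adjunction.mkOfHomEquiv_homEquiv]
  rfl

theorem unit_eq_one_iff {G : PreOrdGrp.{u}} (x : G.carrier) :
    Hom.toMonoidHom (unit G) x = 1 ↔ x ∈ commutator G.carrier := by
  rw [← Abelianization.ker_of]
  exact MonoidHom.mem_ker.symm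

/-- The first projection of a pullback of a regular epimorphism of `Mono(Ab)` along a component of
the unit is again the universal morphism to `Mono(Ab)`. -/
theorem isIso_desc_of_isPullback {B A : PreOrdGrp.{u}} {X : MonoAb.{u}} {φ : X ⟶ reflObj B}
    (hφ : IsConeSurjective φ.hom) {p : A ⟶ X.obj} {q : A ⟶ B}
    (sq : IsPullback p q φ.hom (unit B)) : IsIso (desc p) := by
  have hq : IsConeSurjective q := hφ.of_isPullback sq
  -- Surjectivity of `q` lifts `[B, B]` to `[A, A]`, and `p` is trivial on `[A, A]` because `X` is
  -- abelian.
  have hcomm : ∀ g ∈ commutator B.carrier, ∃ a ∈ commutator A.carrier,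
      Hom.toMonoidHom p a = 1 ∧ Hom.toMonoidHom q a = g := by
    have hX : (commutator A.carrier) ≤ (Hom.toMonoidHom p).ker :=
      let := commGroup X
      Abelianization.commutator_subset_ker (A := X.obj.carrier) _
    have hmap : (commutator A.carrier).map (Hom.toMonoidHom q) = commutator B.carrier := by
      rw [commutator_def, commutator_def, Subgroup.map_commutator,
        Subgroup.map_top_of_surjective _ hq.1]
    intro g hg
    rw [← hmap] at hg
    obtain ⟨a, ha, rfl⟩ := hg
    exact ⟨a, ha, hX ha, rfl⟩
  have hsurj : Function.Surjective (Hom.toMonoidHom p) := fun x => by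
    obtain ⟨g, hg⟩ := QuotientGroup.mk_surjective (Hom.toMonoidHom φ.hom x)
    obtain ⟨w, hw, -⟩ := exists_of_isPullback sq (x := x) (y := g) hg.symm
    exact ⟨w, hw⟩
  rw [← ObjectProperty.isIso_hom_iff]
  refine IsConeSurjective.isIso ⟨fun x => ?_, fun x hx => ?_⟩ ?_
  · obtain ⟨w, rfl⟩ := hsurj x
    exact ⟨Abelianization.of w, rfl⟩
  -- With `φ(x) = η(a) / η(b)` and a positive `y` over `η(b)`, the pairs `(x * y, a)` and `(y, b)`
  -- are positive in `A`, and their quotient is sent to `x`.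
  · obtain ⟨a, ha, b, hb, hab⟩ := (mem_reflCone B _).1 (Hom.map_cone φ.hom x hx)
    obtain ⟨y, hy, hyb⟩ := hφ.2 _ (Hom.map_cone (unit B) b hb)
    have hxy : Hom.toMonoidHom φ.hom (x * y) = Hom.toMonoidHom (unit B) a := by
      rw [map_mul, hyb]
      exact (congrArg (· * Abelianization.of b) hab).trans (div_mul_cancel _ _)
    obtain ⟨v, hv, -, hvc⟩ := exists_of_isPullback sq hxy
    obtain ⟨w, hw, -, hwc⟩ := exists_of_isPullback sq hyb
    refine ⟨Abelianization.of v / Abelianization.of w, (mem_reflCone A _).2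
      ⟨v, hvc (mul_mem hx hy) ha, w, hwc hy hb, rfl⟩, ?_⟩
    refine (map_div (Hom.toMonoidHom (desc p).hom) (Hom.toMonoidHom (unit A) v)
      (Hom.toMonoidHom (unit A) w)).trans ?_
    rw [← comp_apply, ← comp_apply, unit_desc, hv, hw, mul_div_cancel_right]
  · refine (injective_iff_map_eq_one _).2 fun z hz => ?_
    obtain ⟨v, rfl⟩ := QuotientGroup.mk_surjective z
    have hpv : Hom.toMonoidHom p v = 1 := hz
    have hqv : Hom.toMonoidHom q v ∈ commutator B.carrier := by
      rw [← unit_eq_one_iff, ← comp_apply, ← sq.w, comp_apply, hpv, map_one]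
    -- The commutator element `a` has the same two projections as `v`, so `v = a` is killed in
    -- `ab(A)`.
    obtain ⟨a, ha, hpa, hqa⟩ := hcomm _ hqv
    have : v = a := ext_of_isPullback sq (hpv.trans hpa.symm) hqa.symm
    exact (unit_eq_one_iff v).2 (this ▸ ha)

end PreOrdGrp

theorem mainTheorem3 :
    ∃ h : IsGaloisStructure PreOrdGrp.reflAdj.{u}
        (MorphismProperty.regularEpi PreOrdGrp.{u})
        (MorphismProperty.regularEpi PreOrdGrp.MonoAb.{u}),
      h.IsAdmissible := by
  refine ⟨PreOrdGrp.isGaloisStructure, fun B => ?_⟩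
  let h := PreOrdGrp.isGaloisStructure.{u}
  have hiso (X : Extensions (MorphismProperty.regularEpi PreOrdGrp.MonoAb.{u})
      (PreOrdGrp.refl.obj B)) : IsIso ((h.extAdj B).counit.app X) := by
    have := h.hasPullback_unit B X
    have sq := IsPullback.of_hasPullback (PreOrdGrp.inclusion.map X.obj.hom)
      (PreOrdGrp.reflAdj.unit.app B)
    -- The counit is the transpose of the identity of the pullback, which is the transpose of the
    -- first projection.
    have hc : ((h.extAdj B).counit.app X).hom.left = PreOrdGrp.desc
        (pullback.fst (PreOrdGrp.inclusion.map X.obj.hom) (PreOrdGrp.reflAdj.unit.app B)) := by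
      simp only [IsGaloisStructure.extAdj, Adjunction.mkOfHomEquiv_counit_app]
      refine (congrArg (PreOrdGrp.reflAdj.homEquiv _ _).symm (Category.id_comp _)).trans ?_
      exact PreOrdGrp.reflAdj_homEquiv_symm _
    have : IsIso ((h.extAdj B).counit.app X).hom.left := hc ▸
      PreOrdGrp.isIso_desc_of_isPullback ((PreOrdGrp.isRegularEpi_monoAb_iff _).1 X.property) sq
    have : IsIso ((h.extAdj B).counit.app X).hom := 
      haveI : IsIso ((Over.forget _).map ((h.extAdj B).counit.app X).hom) := this
      isIso_of_reflects_iso _ (Over.forget _)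
    exact (ObjectProperty.isIso_hom_iff _).1 this
  exact NatIso.isIso_of_isIso_app _
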